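/- Let $N\ge 2$, and let $e_i,f_i,h_i$ ($1\le i\le N$) be the standard Chevalley generators of $\mathfrak{sl}_{N+1}(\mathbb C)$, $\lambda_1,\dots,\lambda_{N+1}$ the weights of the standard representation ($\lambda_1+\dots+\lambda_{N+1}=0$), and $\alpha_i=\lambda_i-\lambda_{i+1}$ the simple roots. Let $L_{\Lambda(1)}$, $L_{\Lambda(0)}$ be finite-dimensional irreducible $\mathfrak{sl}_{N+1}$-modules with highest weights $\Lambda(1),\Lambda(0)$ and highest weight vectors $\mathbf v_1,\mathbf v_0$; put $L=L_{\Lambda(1)}\otimes L_{\Lambda(0)}$. For $\mathbf k=(k_1,\dots,k_N)\in\mathbb Z_{\ge0}^N$ let $\Lambda(\mathbf k)=\Lambda(1)+\Lambda(0)-\sum_i k_i\alpha_i$, and let $\mathbf t=(t_l(i))_{1\le i\le N,\,1\le l\le k_i}$ be complex numbers that are pairwise distinct and different from $0$ and $1$. The universal weight function is $$\mathbf v_{\mathbf k}(\mathbf t)=\sum_{(\mathbf F_1,\mathbf F_0)}\omega_{(\mathbf F_1,\mathbf F_0)}(\mathbf t)\;\mathbf F_1\mathbf v_1\otimes \mathbf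 F_0\mathbf v_0\in L ,$$ the sum being over all pairs of words in the letters $f_1,\dots,f_N$ in which each $f_i$ occurs exactly $k_i$ times in total. Here $\omega_{(\mathbf F_1,\mathbf F_0)}$ is the sum of the function $g_{(\mathbf F_1,\mathbf F_0)}$ over the permutations in $S_{k_1}\times\dots\times S_{k_N}$ of the variables, where $S_{k_i}$ permutes $t_1(i),\dots,t_{k_i}(i)$, and $g_{(\mathbf F_1,\mathbf F_0)}$ is defined as follows: in the concatenated word $\mathbf F_1\mathbf F_0$ replace, for each $i$, the $l$-th occurrence of $f_i$ from the left by $t_l(i)$; if $\mathbf F_1$ becomes $a_1\dots a_p$ and $\mathbf F_0$ becomes $b_1\dots b_q$, then $$g_{(\mathbf F_1,\mathbf F_0)}=\frac1{(a_1-a_2)\cdots(a_{p-1}-a_p)(a_p-1)}\cdot\frac1{(b_1-b_2)\cdots(b_{q-1}-b_q)\,b_q},$$ a factor belonging to an empty word being $1$. The Bethe system for $\mathbf k$ is, for $1\le i\le N$, $1\le l\le k_i$, $$\sum_{s\ne l}\frac{2}{t_l(i)-t_s(i)}-\sum_{|j-i|=1}\ \sum_{s=1}^{k_j}\frac1{t_l(i)-t_s(j)}-\frac{(\Lambda(0),\alpha_i)}{t_l(i)}-\frac{(\Lambda(1),\alpha_i)}{t_l(i)-1}=0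 .$$ A Bethe vector in $L$ is a vector $\mathbf v_{\mathbf k}(\mathbf t)$, where $\Lambda(\mathbf k)$ is the highest weight of an irreducible component of $L$ and $\mathbf t$ (as above) is a solution of the Bethe system for $\mathbf k$. **Corollary.** (1) If $\Lambda(0)=m\lambda_1$ for an integer $m\ge0$ (that is, $L_{\Lambda(0)}$ is the $m$-th symmetric power of the standard representation), $\mathbf k=(k_1,k_2,0,\dots,0)$, and $\Lambda(\mathbf k)=\Lambda(1)+\Lambda(0)-k_1\alpha_1-k_2\alpha_2$ is the highest weight of an irreducible component of $L$, then $\mathbf v_{\mathbf k}(\mathbf t)\neq0$ for all $\mathbf t$ as above. (2) If $N=2$ (so that $L_{\Lambda(1)},L_{\Lambda(0)}$ are $\mathfrak{sl}_3$-modules) and $\Lambda(0)=m\lambda_1$ or $\Lambda(1)=m\lambda_1$ for some integer $m\ge0$, then every Bethe vector in $L$ is non-zero. -/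

import Mathlib

open scoped TensorProduct

universe u v

noncomputable section

namespace Gaudin

/-- The Lie algebra `sl_{N+1}(ℂ)`. -/
abbrev SL (N : ℕ) := LieAlgebra.SpecialLinear.sl (Fin (N + 1)) ℂ

/-- The Chevalley generator `e_i = E_{i,i+1}` (with indices starting from `0`, so that the root
`α_i` of the literature is number `i - 1` here). -/
def chevE {N : ℕ} (i : Fin N) : SL N :=
  LieAlgebra.SpecialLinear.single i.castSucc i.succ i.castSucc_lt_succ.ne 1

/-- The Chevalley generator `f_i = E_{i+1,i}`. -/
def chevF {N : ℕ} (i : Fin N) : SL N :=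
  LieAlgebra.SpecialLinear.single i.succ i.castSucc i.castSucc_lt_succ.ne' 1

/-- The Chevalley generator `h_i = E_{i,i} - E_{i+1,i+1}`. -/
def chevH {N : ℕ} (i : Fin N) : SL N :=
  LieAlgebra.SpecialLinear.singleSubSingle i.castSucc i.succ 1

/-- An integral weight `Λ` of `sl_{N+1}`, given by the integers `Λ i = (Λ, α_i)`, that is, by the
values of `Λ` on the `h_i`. -/
abbrev Weight (N : ℕ) := Fin N → ℤ

/-- The weights `λ_1, …, λ_{N+1}` of the standard representation (numbered from `0`);
their sum is `0`. -/
def lam {N : ℕ} (j : Fin (N + 1)) : Weight N := fun i =>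
  (if i.castSucc = j then 1 else 0) - (if i.succ = j then 1 else 0)

/-- The simple roots `α_i = λ_i - λ_{i+1}`. -/
def simpleRoot {N : ℕ} (i : Fin N) : Weight N := lam i.castSucc - lam i.succ

/-- The weight `Λ(k) = Λ(1) + Λ(0) - ∑ k_i α_i`. -/
def bigLambda {N : ℕ} (Λ₁ Λ₀ : Weight N) (k : Fin N → ℕ) : Weight N :=
  Λ₁ + Λ₀ - ∑ i, k i • simpleRoot i

section Modules

variable {N : ℕ} {V : Type*} [AddCommGroup V] [Module ℂ V] [LieRingModule (SL N) V]

/-- `x` is a highest weight vector (a non-zero singular vector) of weight `Λ`. -/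
def IsHighestWeightVector (Λ : Weight N) (x : V) : Prop :=
  x ≠ 0 ∧ (∀ i : Fin N, ⁅(chevE i : SL N), x⁆ = 0) ∧
    ∀ i : Fin N, ⁅(chevH i : SL N), x⁆ = (Λ i : ℂ) • x

/-- `Λ` is the highest weight of an irreducible component of the module `V`. -/
def IsComponentHighestWeight (V : Type*) [AddCommGroup V] [Module ℂ V] [LieRingModule (SL N) V]
    [LieModule ℂ (SL N) V] (Λ : Weight N) : Prop :=
  ∃ W : LieSubmodule ℂ (SL N) V,
    LieModule.IsIrreducible ℂ (SL N) W ∧ ∃ w : W, IsHighestWeightVector Λ w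

/-- The action on `x` of a word `f_{i_1} … f_{i_s}` (the leftmost letter acts last). -/
def wordAct (F : List (Fin N)) (x : V) : V :=
  F.foldr (fun i y => ⁅(chevF i : SL N), y⁆) x

end Modules

/-- There are finitely many pairs of words with prescribed total numbers of letters. -/
theorem wordPairs_finite {N : ℕ} (k : Fin N → ℕ) :
    {p : List (Fin N) × List (Fin N) | ∀ i, (p.1 ++ p.2).count i = k i}.Finite := by
  have hfin : {l : List (Fin N) | l.length ≤ ∑ i, k i}.Finite := List.finite_length_le _ _
  refine (hfin.prod hfin).subset ?_
  rintro ⟨a, b⟩ h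
  have hlen : (a ++ b).length = ∑ i, k i := by
    rw [← Finset.sum_congr rfl fun i _ => h i]
    have := Multiset.sum_count_eq_card (s := Finset.univ) (m := ((a ++ b : List (Fin N)) :
      Multiset (Fin N))) (fun i _ => Finset.mem_univ i)
    simpa only [Multiset.coe_count, Multiset.coe_card] using this.symm
  rw [List.length_append] at hlen
  simp only [Set.mem_prod, Set.mem_ofPred_eq]
  omega

/-- The pairs of words `(F₁, F₀)` in the letters `f_1, …, f_N` in which `f_i` occurs exactly
`k_i` times in total. -/
def wordPairs {N : ℕ} (k : Fin N → ℕ) : Finset (List (Fin N) × List (Fin N)) :=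
  (wordPairs_finite k).toFinset

/-- The values of the variables `t_1(i), …, t_{k_i}(i)`, `i = 1, …, N`. -/
abbrev Vars {N : ℕ} (k : Fin N → ℕ) := (i : Fin N) → Fin (k i) → ℂ

/-- Replace, for every `i`, the first occurrence of the letter `f_i` in a word by `t_1(i)`, the
second one by `t_2(i)`, and so on. The value `0` serves only for words with more than `k_i`
letters `f_i`, which do not occur below. -/
def substVars {N : ℕ} {k : Fin N → ℕ} (t : Vars k) (w : List (Fin N)) : List ℂ :=
  w.mapIdx fun p i =>
    if h : (w.take p).count i < k i then t i ⟨(w.take p).count i, h⟩ else 0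

/-- The fraction `1 / ((a_1 - a_2) (a_2 - a_3) ⋯ (a_{s-1} - a_s) (a_s - z))`
(equal to `1` for the empty row). -/
def rowFraction (z : ℂ) : List ℂ → ℂ
  | [] => 1
  | [a] => 1 / (a - z)
  | a :: b :: l => 1 / (a - b) * rowFraction z (b :: l)

/-- The rational function `g_{(F₁,F₀)}(t)` for the points `z_1 = 1` and `z_0 = 0`. -/
def gFun {N : ℕ} {k : Fin N → ℕ} (p : List (Fin N) × List (Fin N)) (t : Vars k) : ℂ :=
  rowFraction 1 ((substVars t (p.1 ++ p.2)).take p.1.length) *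
    rowFraction 0 ((substVars t (p.1 ++ p.2)).drop p.1.length)

/-- The symmetrization of `g_{(F₁,F₀)}` over `S_{k_1} × ⋯ × S_{k_N}`. -/
def omegaFun {N : ℕ} {k : Fin N → ℕ} (p : List (Fin N) × List (Fin N)) (t : Vars k) : ℂ :=
  ∑ π : (i : Fin N) → Equiv.Perm (Fin (k i)), gFun p (fun i l => t i (π i l))

/-- The domain of the universal weight function: the `t_l(i)` are pairwise distinct, and different
from the points `0` and `1`. -/
def InDomain {N : ℕ} {k : Fin N → ℕ} (t : Vars k) : Prop :=
  Function.Injective (fun q : (i : Fin N) × Fin (k i) => t q.1 q.2) ∧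
    ∀ i l, t i l ≠ 0 ∧ t i l ≠ 1

/-- The Bethe system for the weights `Λ(1)`, `Λ(0)` at the points `z_1 = 1`, `z_0 = 0`
(the second sum runs over the roots `α_j` adjacent to `α_i`). -/
def BetheSystem {N : ℕ} (Λ₁ Λ₀ : Weight N) {k : Fin N → ℕ} (t : Vars k) : Prop :=
  ∀ (i : Fin N) (l : Fin (k i)),
    (∑ s ∈ Finset.univ.erase l, 2 / (t i l - t i s)) -
      (∑ j ∈ Finset.univ.filter (fun j : Fin N => (j : ℕ) + 1 = i ∨ (i : ℕ) + 1 = j),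
        ∑ s, 1 / (t i l - t j s)) -
      (Λ₀ i : ℂ) / t i l - (Λ₁ i : ℂ) / (t i l - 1) = 0

section Tensor

variable {N : ℕ} {V₁ V₀ : Type*}
  [AddCommGroup V₁] [Module ℂ V₁] [LieRingModule (SL N) V₁] [LieModule ℂ (SL N) V₁]
  [AddCommGroup V₀] [Module ℂ V₀] [LieRingModule (SL N) V₀] [LieModule ℂ (SL N) V₀]

/-- The universal weight function
`v_k(t) = ∑ ω_{(F₁,F₀)}(t) F₁ v₁ ⊗ F₀ v₀` with values in `V₁ ⊗ V₀`. -/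
def universalWeight (v₁ : V₁) (v₀ : V₀) {k : Fin N → ℕ} (t : Vars k) : V₁ ⊗[ℂ] V₀ :=
  ∑ p ∈ wordPairs k, omegaFun p t • (wordAct p.1 v₁ ⊗ₜ[ℂ] wordAct p.2 v₀)

/-- `x` is a Bethe vector in `V₁ ⊗ V₀` (the factors having highest weight vectors `v₁`, `v₀` of
weights `Λ₁`, `Λ₀`): the value of the universal weight function at a solution of the Bethe system
that belongs to a highest weight `Λ(k)` of an irreducible component of `V₁ ⊗ V₀`. -/
def IsBetheVector (Λ₁ Λ₀ : Weight N) (v₁ : V₁) (v₀ : V₀) (x : V₁ ⊗[ℂ] V₀) : Prop :=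
  ∃ (k : Fin N → ℕ) (t : Vars k),
    IsComponentHighestWeight (V₁ ⊗[ℂ] V₀) (bigLambda Λ₁ Λ₀ k) ∧
      InDomain t ∧ BetheSystem Λ₁ Λ₀ t ∧ x = universalWeight v₁ v₀ t

end Tensor

end Gaudin

end

/-!
A tensor `w ∈ V₁ ⊗ V₀` is a pairing `β` of the dual modules, and `w` is singular exactly when the
`e_i` move across `β` with a sign. The dual modules are generated by the `e_i` from lowest weight
functionals `φ₁`, `φ₀`. Starting from a nonzero value `β (E φ₁) (E' φ₀)`, where `E` and `E'` are
words in the `e_i`, all letters can be moved to `φ₀`. If `w` has weight `Λ(k)` with `k` supported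
on `{i, j}` and `(Λ₀, α_j) = 0`, then `e_j φ₀ = 0`, and the relations
`[e_i, [e_i, e_j]] = [e_j, [e_i, e_j]] = 0` make every word of content `k` act on `φ₀` as a multiple
of `e_j ^ k_j * e_i ^ k_i`. Moving the `e_j` back shows that `e_j ^ k_j φ₁` and `e_i ^ k_i φ₀` are
nonzero. For weight reasons, pairing the universal weight function with these two functionals leaves
only the term of the words `f_j ^ k_j` and `f_i ^ k_i`, whose coefficient symmetrizes to the product
of the factors `1 / (t_l(j) - 1)` and `1 / t_l(i)`.
-/

noncomputable section

namespace Gaudin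

open LieAlgebra.SpecialLinear

section SpecialLinear

variable {n R : Type*} [DecidableEq n] [Fintype n] [CommRing R] {a b c d : n}

theorem single_lie_single (hab : a ≠ b) (hbc : b ≠ c) (hac : a ≠ c) (r s : R) :
    ⁅single a b hab r, single b c hbc s⁆ = single a c hac (r * s) := by
  ext : 1
  simp [Ring.lie_def, hac.symm]

theorem single_lie_single_of_ne (hab : a ≠ b) (hcd : c ≠ d) (hbc : b ≠ c) (hda : d ≠ a)
    (r s : R) : ⁅single a b hab r, single c d hcd s⁆ = 0 := by
  ext : 1
  simp [Ring.lie_def, hbc, hda]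

theorem single_lie_single_swap (hab : a ≠ b) (r s : R) :
    ⁅single a b hab r, single b a hab.symm s⁆ = singleSubSingle a b (r * s) := by
  ext : 1
  simp [Ring.lie_def, mul_comm]

theorem single_lie_single_lie_single (hab : a ≠ b) (hcd : c ≠ d) (h : ¬(b = c ∧ a = d))
    (r s : R) : ⁅⁅single a b hab r, single c d hcd s⁆, single a b hab r⁆ = 0 := by
  ext : 1
  rw [sl_bracket, sl_bracket]
  set X : Matrix n n R := (single a b hab r).val with hX
  set Y : Matrix n n R := (single c d hcd s).val with hY
  have mul_self : X * X = 0 := by simp [hX, hab.symm]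
  have sandwich : X * Y * X = 0 := by
    obtain hbc | hda : b ≠ c ∨ d ≠ a := by tauto
    · simp [hX, hY, hbc]
    · simp [hX, hY, hda, mul_assoc]
  simp only [sub_mul, mul_sub, ← mul_assoc, sandwich, mul_self, zero_mul]
  simp [mul_assoc, mul_self]

theorem singleSubSingle_lie_single (hcd : c ≠ d) :
    ⁅singleSubSingle a b (1 : R), single c d hcd (1 : R)⁆ =
      (((if a = c then 1 else 0) - (if b = c then 1 else 0)) -
        ((if a = d then 1 else 0) - (if b = d then 1 else 0)) : R) • single c d hcd (1 : R) := by
  have diagonal_mul (x : n) : Matrix.single x x (1 : R) * Matrix.single c d 1 =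
      (if x = c then 1 else 0 : R) • Matrix.single c d 1 := by
    split_ifs with h <;> simp [h]
  have mul_diagonal (x : n) : Matrix.single c d (1 : R) * Matrix.single x x 1 =
      (if x = d then 1 else 0 : R) • Matrix.single c d 1 := by
    split_ifs with h
    · simp [h]
    · simp [Ne.symm h]
  ext : 1
  simp only [sl_bracket, val_singleSubSingle, val_single, sub_mul, mul_sub, diagonal_mul,
    mul_diagonal, ← sub_smul]
  rfl

theorem singleSubSingle_lie_singleSubSingle (r s : R) :
    ⁅singleSubSingle a b r, singleSubSingle c d s⁆ = 0 := by
  have commute_diagonal (x y : n) :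
      Matrix.single x x r * Matrix.single y y s = Matrix.single y y s * Matrix.single x x r := by
    by_cases h : x = y
    · simp [h, mul_comm]
    · simp [h, Ne.symm h]
  ext : 1
  simp only [sl_bracket, val_singleSubSingle, sub_mul, mul_sub, commute_diagonal]
  simp [sub_sub_sub_comm]

theorem eq_sum_single (o : n) (x : LieAlgebra.SpecialLinear.sl n R) :
    x = ∑ a, ∑ b, if h : a = b then singleSubSingle a o (x.val a a)
      else single a b h (x.val a b) := by
  have trace_eq_zero : ∑ a, x.val a a = 0 := x.property
  have val_summand (a b : n) :
      ((if h : a = b then singleSubSingle a o (x.val a a) else single a b h (x.val a b) :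
        LieAlgebra.SpecialLinear.sl n R)).val =
      Matrix.single a b (x.val a b) - if a = b then Matrix.single o o (x.val a a) else 0 := by
    split_ifs with h
    · subst h; simp
    · simp
  ext : 1
  simp_rw [AddSubmonoidClass.coe_finsetSum, val_summand, Finset.sum_sub_distrib]
  rw [← Matrix.matrix_eq_sum_single]
  have sum_corner : ∑ a, Matrix.single o o (x.val a a) = 0 := by
    have := map_sum (Matrix.singleAddMonoidHom (α := R) o o) (fun a => x.val a a) Finset.univ
    rw [trace_eq_zero, map_zero] at this
    exact this.symm
  simp [sum_corner]

theorem lieSubalgebra_eq_top_of_single_mem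
    (K : LieSubalgebra R (LieAlgebra.SpecialLinear.sl n R))
    (hK : ∀ (a b : n) (h : a ≠ b), single a b h 1 ∈ K) : K = ⊤ := by
  have single_mem (a b : n) (h : a ≠ b) (r : R) : single a b h r ∈ K := by
    simpa [← map_smul] using K.smul_mem r (hK a b h)
  have singleSubSingle_mem (a b : n) (r : R) : singleSubSingle a b r ∈ K := by
    by_cases h : a = b
    · subst h
      rw [show singleSubSingle a a r = 0 by ext : 1; simp]
      exact K.zero_mem
    · simpa [single_lie_single_swap] using K.lie_mem (single_mem a b h r) (hK b a (Ne.symm h))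
  rw [eq_top_iff]
  intro x _
  obtain _ | ⟨⟨o⟩⟩ := isEmpty_or_nonempty n
  · rw [Subsingleton.elim x 0]
    exact K.zero_mem
  · rw [eq_sum_single o x]
    refine sum_mem fun a _ => sum_mem fun b _ => ?_
    split_ifs with h
    · exact singleSubSingle_mem a o _
    · exact single_mem a b h _

end SpecialLinear

section ChevalleyGenerators

variable {N : ℕ}

theorem chevE_lie_chevF_self (i : Fin N) : ⁅(chevE i : SL N), chevF i⁆ = chevH i :=
  (single_lie_single_swap (R := ℂ) i.castSucc_lt_succ.ne 1 1).trans (by rw [mul_one]; rfl)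

theorem chevE_lie_chevF_of_ne {i j : Fin N} (h : i ≠ j) : ⁅(chevE i : SL N), chevF j⁆ = 0 :=
  single_lie_single_of_ne _ _ (by simpa using h) (by simpa using h.symm) _ _

theorem chevH_lie_chevE (i j : Fin N) :
    ⁅(chevH i : SL N), chevE j⁆ = (simpleRoot j i : ℂ) • (chevE j : SL N) := by
  rw [chevH, chevE, singleSubSingle_lie_single]
  simp only [simpleRoot, lam, Pi.sub_apply]
  push_cast
  rfl

theorem chevH_lie_chevF (i j : Fin N) :
    ⁅(chevH i : SL N), chevF j⁆ = (-(simpleRoot j i : ℂ)) • (chevF j : SL N) := by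
  rw [chevH, chevF, singleSubSingle_lie_single]
  simp only [simpleRoot, lam, Pi.sub_apply]
  push_cast
  congr 1
  ring

theorem chevH_lie_chevH (i j : Fin N) : ⁅(chevH i : SL N), chevH j⁆ = 0 :=
  singleSubSingle_lie_singleSubSingle _ _

theorem chevE_lie_chevE_lie_chevE (i j : Fin N) :
    ⁅⁅(chevE i : SL N), chevE j⁆, chevE i⁆ = 0 :=
  single_lie_single_lie_single _ _
    (by simp only [Fin.ext_iff, Fin.val_castSucc, Fin.val_succ]; omega) _ _

theorem lieSubalgebra_eq_top (K : LieSubalgebra ℂ (SL N)) (hE : ∀ i, chevE i ∈ K)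
    (hF : ∀ i, chevF i ∈ K) : K = ⊤ := by
  let Reaches (a b : Fin (N + 1)) : Prop := ∀ h : a ≠ b, single a b h 1 ∈ K
  have trans {a b c : Fin (N + 1)} (hab : Reaches a b) (hbc : Reaches b c) : Reaches a c := by
    intro hac
    by_cases h : a = b
    · subst h; exact hbc hac
    by_cases h' : b = c
    · subst h'; exact hab hac
    · simpa [single_lie_single h h' hac] using K.lie_mem (hab h) (hbc h')
  have from_zero (a : Fin (N + 1)) : Reaches 0 a :=
    a.induction (fun h => absurd rfl h) fun i ih => trans ih fun _ => hE i
  have to_zero (a : Fin (N + 1)) : Reaches a 0 :=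
    a.induction (fun h => absurd rfl h) fun i ih => trans (fun _ => hF i) ih
  exact lieSubalgebra_eq_top_of_single_mem K fun a b => trans (to_zero a) (from_zero b)

theorem smul_lam_zero_apply (m : ℕ) {j : Fin N} (hj : (j : ℕ) ≠ 0) :
    (m • lam 0 : Weight N) j = 0 := by
  simp [lam, Fin.ext_iff, hj]

theorem simpleRoot_apply_eq_sum (i j : Fin N) :
    simpleRoot i j = ∑ a, lam a i * lam a j := by
  simp [simpleRoot, lam, sub_mul, Finset.sum_sub_distrib]

theorem linearIndependent_simpleRoot :
    LinearIndependent ℤ (simpleRoot : Fin N → Weight N) := by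
  rw [Fintype.linearIndependent_iff]
  intro c hc
  have lam_combination (a : Fin (N + 1)) : ∑ i, c i * lam a i = 0 := by
    have gram (j : Fin N) : ∑ a, (∑ i, c i * lam a i) * lam a j = 0 := by
      have := congrFun hc j
      simp_rw [Finset.sum_apply, Pi.smul_apply, simpleRoot_apply_eq_sum, smul_eq_mul,
        Finset.mul_sum] at this
      rw [Finset.sum_comm] at this
      simpa only [Finset.sum_mul, mul_assoc, Pi.zero_apply] using this
    have sum_sq : ∑ a, (∑ i, c i * lam a i) ^ 2 = 0 := by
      calc ∑ a, (∑ i, c i * lam a i) ^ 2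
          = ∑ a, ∑ j, c j * ((∑ i, c i * lam a i) * lam a j) := by
            simp_rw [sq, Finset.mul_sum, mul_left_comm]
        _ = ∑ j, c j * ∑ a, (∑ i, c i * lam a i) * lam a j := by
            simp_rw [Finset.sum_comm (γ := Fin (N + 1)), Finset.mul_sum]
        _ = 0 := by simp [gram]
    simpa using (Finset.sum_eq_zero_iff_of_nonneg fun a _ => sq_nonneg _).1 sum_sq a
      (Finset.mem_univ a)
  intro j
  induction j using WellFoundedLT.induction with
  | ind j ih =>
    have previous : ∑ i, (if i.succ = j.castSucc then c i else 0) = 0 :=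
      Finset.sum_eq_zero fun i _ => ite_eq_right_iff.2 fun h =>
        ih i (by simp only [Fin.ext_iff, Fin.val_succ, Fin.val_castSucc] at h; omega)
    simpa [lam, mul_sub, Finset.sum_sub_distrib, previous] using lam_combination j.castSucc

theorem sum_map_simpleRoot_eq_iff {F : List (Fin N)} {k : Fin N → ℕ} :
    (F.map simpleRoot).sum = ∑ i, k i • simpleRoot i ↔ ∀ i, F.count i = k i := by
  have sum_map : (F.map simpleRoot).sum = ∑ i, (F.count i : ℤ) • simpleRoot i := by
    rw [Finset.sum_list_map_count]
    simp_rw [natCast_zsmul]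
    exact Finset.sum_subset (Finset.subset_univ _) fun i _ hi => by
      rw [List.count_eq_zero.2 (by simpa using hi), zero_smul]
  have sum_smul : ∑ i, k i • simpleRoot i = ∑ i, (k i : ℤ) • simpleRoot i := by
    simp_rw [natCast_zsmul]
  rw [sum_map, sum_smul]
  refine linearIndependent_simpleRoot.fintypeLinearCombination_injective.eq_iff.trans ?_
  simp [funext_iff]

end ChevalleyGenerators

/-- The vector `g_{i_1} ⋯ g_{i_s} x` for a word `i_1 … i_s` whose letters stand for elements `g i`
of a Lie algebra. With `g = chevF` this is `wordAct`. -/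
def lieWord {ι L M : Type*} [Bracket L M] (g : ι → L) (F : List ι) (x : M) : M :=
  F.foldr (fun i y => ⁅g i, y⁆) x

@[simp]
theorem lieWord_nil {ι L M : Type*} [Bracket L M] (g : ι → L) (x : M) : lieWord g [] x = x := rfl

@[simp]
theorem lieWord_cons {ι L M : Type*} [Bracket L M] (g : ι → L) (i : ι) (F : List ι) (x : M) :
    lieWord g (i :: F) x = ⁅g i, lieWord g F x⁆ := rfl

theorem lieWord_append {ι L M : Type*} [Bracket L M] (g : ι → L) (F G : List ι) (x : M) :
    lieWord g (F ++ G) x = lieWord g F (lieWord g G x) :=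
  List.foldr_append

section LieWord

variable {ι R L M : Type*} [CommRing R] [LieRing L] [LieAlgebra R L] [AddCommGroup M] [Module R M]
  [LieRingModule L M] [LieModule R L M]

variable (R) in
theorem lie_mem_span_lieWord (g : ι → L) (i : ι) (x : M) {y : M}
    (hy : y ∈ Submodule.span R (Set.range fun F => lieWord g F x)) :
    ⁅g i, y⁆ ∈ Submodule.span R (Set.range fun F => lieWord g F x) := by
  suffices Submodule.span R (Set.range fun F => lieWord g F x) ≤
      (Submodule.span R (Set.range fun F => lieWord g F x)).comap (LieModule.toEnd R L M (g i)) from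
    this hy
  rw [Submodule.span_le, Set.range_subset_iff]
  exact fun F => Submodule.subset_span ⟨i :: F, rfl⟩

theorem lie_mem_span_lieWord_of_lie_eq_zero {g g' : ι → L} {x : M} (hx : ∀ i, ⁅g' i, x⁆ = 0)
    (hne : ∀ i j, i ≠ j → ⁅g' i, g j⁆ = 0)
    (hself : ∀ i F, ⁅⁅g' i, g i⁆, lieWord g F x⁆ ∈
      Submodule.span R (Set.range fun F => lieWord g F x)) (i : ι) {y : M}
    (hy : y ∈ Submodule.span R (Set.range fun F => lieWord g F x)) :
    ⁅g' i, y⁆ ∈ Submodule.span R (Set.range fun F => lieWord g F x) := by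
  suffices Submodule.span R (Set.range fun F => lieWord g F x) ≤
      (Submodule.span R (Set.range fun F => lieWord g F x)).comap
        (LieModule.toEnd R L M (g' i)) from this hy
  rw [Submodule.span_le, Set.range_subset_iff]
  intro F
  rw [SetLike.mem_coe, Submodule.mem_comap, LieModule.toEnd_apply_apply]
  induction F with
  | nil => simp [hx]
  | cons j F ih =>
    rw [lieWord_cons, leibniz_lie]
    refine Submodule.add_mem _ ?_ (lie_mem_span_lieWord R g j x ih)
    obtain rfl | hij := eq_or_ne i j
    · exact hself i F
    · simp [hne i j hij]

theorem lieWord_replicate (g : ι → L) (n : ℕ) (i : ι) (x : M) :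
    lieWord g (List.replicate n i) x = (LieModule.toEnd R L M (g i) ^ n) x := by
  induction n with
  | zero => rfl
  | succ n ih =>
    rw [List.replicate_succ, lieWord_cons, ih, pow_succ', Module.End.mul_apply]
    rfl

end LieWord

section Weights

theorem eq_zero_of_mem_span_of_commute {ι K M : Type*} [Field K] [AddCommGroup M] [Module K M]
    (f : ι → Module.End K M) (hf : ∀ i j, Commute (f i) (f j)) {χ : ι → K} {x : M}
    (hx : ∀ i, f i x = χ i • x) {s : Set M} (hs : ∀ y ∈ s, ∃ ψ ≠ χ, ∀ i, f i y = ψ i • y)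
    (hxs : x ∈ Submodule.span K s) : x = 0 := by
  let W (ψ : ι → K) : Submodule K M := ⨅ i, (f i).maxGenEigenspace (ψ i)
  have mem_W {ψ : ι → K} {y : M} (hy : ∀ i, f i y = ψ i • y) : y ∈ W ψ :=
    (Submodule.mem_iInf _).2 fun i => Module.End.genEigenspace_le_maximal _ _ 1
      (Module.End.mem_eigenspace_iff.2 (hy i))
  have independent : iSupIndep W :=
    Module.End.independent_iInf_maxGenEigenspace_of_forall_mapsTo f fun i j c =>
      Module.End.mapsTo_maxGenEigenspace_of_comm (hf j i) c
  refine Submodule.disjoint_def.1 (independent χ) x (mem_W hx) (Submodule.span_le.2 ?_ hxs)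
  intro y hy
  obtain ⟨ψ, hψ, hψy⟩ := hs y hy
  exact Submodule.mem_iSup_of_mem ψ (Submodule.mem_iSup_of_mem hψ (mem_W hψy))

variable {N : ℕ} {V : Type*} [AddCommGroup V] [Module ℂ V] [LieRingModule (SL N) V] {μ ν : Weight N}
  {x : V}

/-- `x` lies in the weight space of weight `μ`. The zero vector is allowed, so that the generators
preserve weight vectors unconditionally. -/
def HasWeight (μ : Weight N) (x : V) : Prop :=
  ∀ i : Fin N, ⁅(chevH i : SL N), x⁆ = (μ i : ℂ) • x

/-- `x` is a lowest weight vector of weight `μ`. Such vectors arise as functionals on a highest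
weight module, and generate the part of the dual that separates its points. -/
def IsLowestWeightVector (μ : Weight N) (x : V) : Prop :=
  x ≠ 0 ∧ (∀ i : Fin N, ⁅(chevF i : SL N), x⁆ = 0) ∧ HasWeight μ x

theorem IsHighestWeightVector.hasWeight (hx : IsHighestWeightVector μ x) : HasWeight μ x := hx.2.2

theorem IsHighestWeightVector.map {W : Type*} [AddCommGroup W] [Module ℂ W]
    [LieRingModule (SL N) W] {f : V →ₗ[ℂ] W} (hx : IsHighestWeightVector μ x) (hfx : f x ≠ 0)
    (hf : ∀ (g : SL N) x, f ⁅g, x⁆ = ⁅g, f x⁆) : IsHighestWeightVector μ (f x) :=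
  ⟨hfx, fun i => by rw [← hf, hx.2.1, map_zero], fun i => by rw [← hf, hx.2.2, map_smul]⟩

variable [LieModule ℂ (SL N) V]

theorem HasWeight.lie_chevE (hx : HasWeight μ x) (j : Fin N) :
    HasWeight (μ + simpleRoot j) ⁅(chevE j : SL N), x⁆ := by
  intro i
  rw [leibniz_lie, chevH_lie_chevE, hx i, smul_lie, lie_smul, ← add_smul]
  push_cast [Pi.add_apply]
  rw [add_comm]

theorem HasWeight.lie_chevF (hx : HasWeight μ x) (j : Fin N) :
    HasWeight (μ - simpleRoot j) ⁅(chevF j : SL N), x⁆ := by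
  intro i
  rw [leibniz_lie, chevH_lie_chevF, hx i, smul_lie, lie_smul, ← add_smul]
  push_cast [Pi.sub_apply]
  rw [neg_add_eq_sub]

theorem HasWeight.lieWord_chevE (hx : HasWeight μ x) (F : List (Fin N)) :
    HasWeight (μ + (F.map simpleRoot).sum) (lieWord chevE F x) := by
  induction F with
  | nil => simpa using hx
  | cons i F ih =>
    rw [List.map_cons, List.sum_cons, add_comm (simpleRoot i), ← add_assoc]
    exact ih.lie_chevE i

theorem hasWeight_wordAct (hx : HasWeight μ x) (F : List (Fin N)) :
    HasWeight (μ - (F.map simpleRoot).sum) (wordAct F x) := by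
  induction F with
  | nil => simpa using! hx
  | cons i F ih =>
    rw [List.map_cons, List.sum_cons, add_comm (simpleRoot i), ← sub_sub]
    exact ih.lie_chevF i

theorem HasWeight.eq_zero_of_mem_span {s : Set V} (hx : HasWeight μ x)
    (hs : ∀ y ∈ s, ∃ ν ≠ μ, HasWeight ν y) (hxs : x ∈ Submodule.span ℂ s) : x = 0 := by
  refine eq_zero_of_mem_span_of_commute (fun i => LieModule.toEnd ℂ (SL N) V (chevH i))
    (fun i j => ?_) hx (fun y hy => ?_) hxs
  · refine LinearMap.ext fun y => ?_
    simpa [chevH_lie_chevH] using leibniz_lie (chevH i : SL N) (chevH j : SL N) y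
  · obtain ⟨ν, hν, hy⟩ := hs y hy
    exact ⟨fun i => (ν i : ℂ), fun h => hν (funext fun i => Int.cast_injective (congrFun h i)), hy⟩

theorem HasWeight.add_eq_zero_of_apply_ne_zero {ψ : Module.Dual ℂ V} (hψ : HasWeight μ ψ)
    (hx : HasWeight ν x) (h : ψ x ≠ 0) : μ + ν = 0 := by
  funext i
  have := LinearMap.congr_fun (hψ i) x
  rw [Module.Dual.lie_apply, hx i, map_smul, LinearMap.smul_apply, smul_eq_mul, smul_eq_mul,
    ← neg_mul] at this
  have := mul_right_cancel₀ h this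
  rw [neg_eq_iff_add_eq_zero, add_comm] at this
  exact_mod_cast this

end Weights

section Irreducible

variable {N : ℕ} {V : Type*} [AddCommGroup V] [Module ℂ V] [LieRingModule (SL N) V]
  [LieModule ℂ (SL N) V] {Λ : Weight N} {v x : V}

theorem lie_mem_of_chev (S : Submodule ℂ V) (hE : ∀ (i : Fin N), ∀ x ∈ S, ⁅(chevE i : SL N), x⁆ ∈ S)
    (hF : ∀ i : Fin N, ∀ x ∈ S, ⁅(chevF i : SL N), x⁆ ∈ S) (y : SL N) (hx : x ∈ S) :
    ⁅y, x⁆ ∈ S := by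
  let stabilizer : LieSubalgebra ℂ (SL N) :=
    { carrier := {y | ∀ x ∈ S, ⁅y, x⁆ ∈ S}
      add_mem' := fun ha hb x hx => by
        rw [add_lie]; exact S.add_mem (ha x hx) (hb x hx)
      zero_mem' := fun x _ => by rw [zero_lie]; exact S.zero_mem
      smul_mem' := fun c a ha x hx => by
        rw [smul_lie]; exact S.smul_mem c (ha x hx)
      lie_mem' := fun {a b} ha hb x hx => by
        rw [lie_lie]; exact S.sub_mem (ha _ (hb x hx)) (hb _ (ha x hx)) }
  have : y ∈ stabilizer := by
    rw [lieSubalgebra_eq_top stabilizer hE hF]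
    trivial
  exact this x hx

theorem eq_top_of_chev_mem [LieModule.IsIrreducible ℂ (SL N) V] (S : Submodule ℂ V)
    (hE : ∀ (i : Fin N), ∀ x ∈ S, ⁅(chevE i : SL N), x⁆ ∈ S)
    (hF : ∀ i : Fin N, ∀ x ∈ S, ⁅(chevF i : SL N), x⁆ ∈ S) (hS : S ≠ ⊥) : S = ⊤ := by
  let W : LieSubmodule ℂ (SL N) V :=
    { S with lie_mem := fun {y x} hx => lie_mem_of_chev S hE hF y hx }
  obtain hW | hW := eq_bot_or_eq_top W
  · exact absurd (congrArg LieSubmodule.toSubmodule hW) hS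
  · exact congrArg LieSubmodule.toSubmodule hW

theorem IsHighestWeightVector.span_wordAct_eq_top [LieModule.IsIrreducible ℂ (SL N) V]
    (hv : IsHighestWeightVector Λ v) :
    Submodule.span ℂ (Set.range fun F : List (Fin N) => wordAct F v) = ⊤ := by
  refine eq_top_of_chev_mem _ (fun i _ => lie_mem_span_lieWord_of_lie_eq_zero hv.2.1
    (fun _ _ => chevE_lie_chevF_of_ne) (fun i F => ?_) i)
    (fun i _ => lie_mem_span_lieWord ℂ chevF i v) fun h => hv.1 ?_
  · rw [chevE_lie_chevF_self]
    exact (hasWeight_wordAct hv.hasWeight F i).symm ▸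
      Submodule.smul_mem _ _ (Submodule.subset_span ⟨F, rfl⟩)
  · exact (Submodule.span_eq_bot.1 h) v ⟨[], rfl⟩

theorem IsHighestWeightVector.dual_ext [LieModule.IsIrreducible ℂ (SL N) V]
    (hv : IsHighestWeightVector Λ v) {ψ χ : Module.Dual ℂ V}
    (h : ∀ F : List (Fin N), ψ (wordAct F v) = χ (wordAct F v)) : ψ = χ :=
  LinearMap.ext_on hv.span_wordAct_eq_top (by rintro _ ⟨F, rfl⟩; exact h F)

theorem IsLowestWeightVector.lie_mem_span_lieWord_chevE {ψ : V} (hψ : IsLowestWeightVector Λ ψ)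
    (i : Fin N) {y : V}
    (hy : y ∈ Submodule.span ℂ (Set.range fun E : List (Fin N) => lieWord chevE E ψ)) :
    ⁅(chevF i : SL N), y⁆ ∈
      Submodule.span ℂ (Set.range fun E : List (Fin N) => lieWord chevE E ψ) := by
  refine lie_mem_span_lieWord_of_lie_eq_zero hψ.2.1 (fun i j hij => ?_) (fun i F => ?_) i hy
  · rw [← lie_skew, chevE_lie_chevF_of_ne hij.symm, neg_zero]
  · rw [← lie_skew, chevE_lie_chevF_self, neg_lie, hψ.2.2.lieWord_chevE F i]
    exact Submodule.neg_mem _ (Submodule.smul_mem _ _ (Submodule.subset_span ⟨F, rfl⟩))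

theorem IsHighestWeightVector.notMem_span_wordAct_cons (hv : IsHighestWeightVector Λ v) :
    v ∉ Submodule.span ℂ (Set.range fun p : Fin N × List (Fin N) => wordAct (p.1 :: p.2) v) := by
  refine fun h => hv.1 (hv.hasWeight.eq_zero_of_mem_span ?_ h)
  rintro _ ⟨⟨i, F⟩, rfl⟩
  refine ⟨_, fun h => ?_, hasWeight_wordAct hv.hasWeight _⟩
  have := sum_map_simpleRoot_eq_iff (F := i :: F) (k := 0).1 (by simpa using h) i
  simp at this

theorem IsHighestWeightVector.exists_isLowestWeightVector_dual
    [LieModule.IsIrreducible ℂ (SL N) V] (hv : IsHighestWeightVector Λ v) :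
    ∃ φ : Module.Dual ℂ V, IsLowestWeightVector (-Λ) φ := by
  obtain ⟨φ, hφv, hφ⟩ := Submodule.exists_le_ker_of_notMem hv.notMem_span_wordAct_cons
  have apply_cons (i : Fin N) (F : List (Fin N)) : φ (wordAct (i :: F) v) = 0 :=
    hφ (Submodule.subset_span ⟨(i, F), rfl⟩)
  refine ⟨φ, fun h => hφv (by simp [h]), fun i => hv.dual_ext fun F => ?_,
    fun i => hv.dual_ext fun F => ?_⟩
  · rw [Module.Dual.lie_apply, LinearMap.zero_apply, neg_eq_zero]
    exact apply_cons i F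
  · rw [Module.Dual.lie_apply, hasWeight_wordAct hv.hasWeight F i]
    cases F with
    | nil => simp
    | cons j F => simp [apply_cons j F]

theorem IsLowestWeightVector.eq_zero_of_forall_lieWord_apply_eq_zero
    [LieModule.IsIrreducible ℂ (SL N) V] {φ : Module.Dual ℂ V} (hφ : IsLowestWeightVector Λ φ)
    (hx : ∀ E : List (Fin N), lieWord chevE E φ x = 0) : x = 0 := by
  let S := Submodule.span ℂ (Set.range fun E : List (Fin N) => lieWord chevE E φ)
  have coannihilator_stable (g : SL N) (hg : ∀ ψ ∈ S, ⁅g, ψ⁆ ∈ S) :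
      ∀ y ∈ S.dualCoannihilator, ⁅g, y⁆ ∈ S.dualCoannihilator := by
    simp only [Submodule.mem_dualCoannihilator]
    intro y hy ψ hψ
    have := hy _ (hg ψ hψ)
    rwa [Module.Dual.lie_apply, neg_eq_zero] at this
  by_contra hx0
  have eq_top : S.dualCoannihilator = ⊤ := by
    refine eq_top_of_chev_mem S.dualCoannihilator
      (fun i => coannihilator_stable _ fun ψ => lie_mem_span_lieWord ℂ chevE i φ)
      (fun i => coannihilator_stable _ fun ψ => hφ.lie_mem_span_lieWord_chevE i)
      (Submodule.ne_bot_iff _ |>.2 ⟨x, ?_, hx0⟩)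
    rw [← SetLike.mem_coe, Submodule.coe_dualCoannihilator_span]
    rintro _ ⟨E, rfl⟩
    exact hx E
  have hφS : φ ∈ S := Submodule.subset_span ⟨[], rfl⟩
  exact hφ.1 (LinearMap.ext fun y =>
    (Submodule.mem_dualCoannihilator y).1 (eq_top ▸ Submodule.mem_top) φ hφS)

end Irreducible

section DualWords

variable {N : ℕ} {V : Type*} [AddCommGroup V] [Module ℂ V] [LieRingModule (SL N) V]
  [LieModule ℂ (SL N) V] {Λ : Weight N} {v : V} {φ : Module.Dual ℂ V}

theorem HasWeight.perm_of_lieWord_chevE_apply_wordAct_ne_zero (hφ : HasWeight (-Λ) φ)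
    (hv : HasWeight Λ v) {E F : List (Fin N)} (h : lieWord chevE E φ (wordAct F v) ≠ 0) :
    F.Perm E := by
  have weights := (hφ.lieWord_chevE E).add_eq_zero_of_apply_ne_zero (hasWeight_wordAct hv F) h
  have sums_eq : (F.map simpleRoot).sum = (E.map simpleRoot).sum := by
    linear_combination -weights
  rw [List.perm_iff_count]
  exact sum_map_simpleRoot_eq_iff.1 (sums_eq.trans (sum_map_simpleRoot_eq_iff.2 fun _ => rfl))

variable [LieModule.IsIrreducible ℂ (SL N) V]

theorem IsHighestWeightVector.exists_perm_lieWord_chevE_apply_wordAct_ne_zero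
    (hv : IsHighestWeightVector Λ v) (hφ : HasWeight (-Λ) φ) {E : List (Fin N)}
    (h : lieWord chevE E φ ≠ 0) :
    ∃ F : List (Fin N), F.Perm E ∧ lieWord chevE E φ (wordAct F v) ≠ 0 := by
  contrapose! h
  refine hv.dual_ext fun F => by_contra fun hF => hF ?_
  exact h F (hφ.perm_of_lieWord_chevE_apply_wordAct_ne_zero hv.hasWeight hF)

theorem IsHighestWeightVector.lieWord_chevE_replicate_apply_ne_zero
    (hv : IsHighestWeightVector Λ v) (hφ : HasWeight (-Λ) φ) {n : ℕ} {i : Fin N}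
    (h : lieWord chevE (List.replicate n i) φ ≠ 0) :
    lieWord chevE (List.replicate n i) φ (wordAct (List.replicate n i) v) ≠ 0 := by
  obtain ⟨F, hF, hne⟩ := hv.exists_perm_lieWord_chevE_apply_wordAct_ne_zero hφ h
  rwa [List.perm_replicate.1 hF] at hne

theorem IsHighestWeightVector.lie_chevE_dual_eq_zero (hv : IsHighestWeightVector Λ v)
    (hφ : HasWeight (-Λ) φ) {i : Fin N} (hi : Λ i = 0) : ⁅(chevE i : SL N), φ⁆ = 0 := by
  by_contra h
  obtain ⟨F, hF, hne⟩ :=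
    hv.exists_perm_lieWord_chevE_apply_wordAct_ne_zero (E := [i]) hφ h
  rw [List.perm_singleton.1 hF] at hne
  apply hne
  have e_f_v : ⁅(chevE i : SL N), ⁅(chevF i : SL N), v⁆⁆ = 0 := by
    rw [leibniz_lie, chevE_lie_chevF_self, hv.2.2, hv.2.1, hi]
    simp
  simp [wordAct, e_f_v]

end DualWords

section Heisenberg

theorem mul_pow_succ_eq_of_commute {A : Type*} [Ring A] {p q z : A} (h : p * q = q * p + z)
    (hz : Commute z q) (n : ℕ) : p * q ^ (n + 1) = q ^ (n + 1) * p + (n + 1) • (z * q ^ n) := by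
  induction n with
  | zero => simpa using h
  | succ n ih =>
    calc p * q ^ (n + 2) = p * q ^ (n + 1) * q := by rw [pow_succ _ (n + 1), mul_assoc]
      _ = q ^ (n + 1) * (p * q) + (n + 1) • (z * q ^ (n + 1)) := by
        rw [ih, add_mul, mul_assoc, smul_mul_assoc, mul_assoc, ← pow_succ]
      _ = q ^ (n + 2) * p + (q ^ (n + 1) * z + (n + 1) • (z * q ^ (n + 1))) := by
        rw [h, mul_add, ← mul_assoc, ← pow_succ, add_assoc]
      _ = q ^ (n + 2) * p + (n + 2) • (z * q ^ (n + 1)) := by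
        rw [← (hz.pow_right (n + 1)).eq, ← succ_nsmul']

variable {K M : Type*} [CommRing K] [AddCommGroup M] [Module K M] {p q z : Module.End K M} {y : M}

theorem smul_apply_pow_apply_pow_of_commute (h : p * q = q * p + z) (hzp : Commute z p)
    (hzq : Commute z q) (hy : q y = 0) (a b : ℕ) :
    (a + 1 : K) • p ((q ^ b) ((p ^ a) y)) = (a + 1 - b : K) • (q ^ b) ((p ^ (a + 1)) y) := by
  have lower : q ((p ^ (a + 1)) y) = -(a + 1 : K) • z ((p ^ a) y) := by
    have h' : q * p = p * q + -z := by rw [h]; abel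
    have := congr($(mul_pow_succ_eq_of_commute h' hzp.neg_left a) y)
    simpa [hy, ← Nat.cast_smul_eq_nsmul K, ← neg_smul] using this
  cases b with
  | zero => simp [pow_succ']
  | succ b =>
    have raise := congr($(mul_pow_succ_eq_of_commute h hzq b) ((p ^ a) y))
    have reorder : (q ^ (b + 1)) ((p ^ (a + 1)) y) = -(a + 1 : K) • (z * q ^ b) ((p ^ a) y) := by
      rw [pow_succ, Module.End.mul_apply, lower, map_smul, (hzq.pow_right b).eq]
      rfl
    simp only [LinearMap.add_apply, LinearMap.smul_apply, Module.End.mul_apply] at raise reorder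
    rw [pow_succ' p, Module.End.mul_apply] at reorder ⊢
    rw [raise, smul_add, reorder]
    simp only [← Nat.cast_smul_eq_nsmul K]
    push_cast
    module

end Heisenberg

section LieWordCollapse

variable {ι K L M : Type*} [Field K] [LieRing L] [LieAlgebra K L] [AddCommGroup M]
  [Module K M] [LieRingModule L M] [LieModule K L M] {g : ι → L} {i j : ι} {y : M}

variable (K) [CharZero K]

theorem exists_smul_lie_lieWord_replicate_append (hi : ⁅⁅g i, g j⁆, g i⁆ = 0)
    (hj : ⁅⁅g j, g i⁆, g j⁆ = 0) (hy : ⁅g j, y⁆ = 0) (a b : ℕ) :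
    ∃ c : K, ⁅g i, lieWord g (List.replicate b j ++ List.replicate a i) y⁆ =
      c • lieWord g (List.replicate b j ++ List.replicate (a + 1) i) y := by
  have commute_of_lie_eq_zero {x x' : L} (h : ⁅x, x'⁆ = 0) :
      Commute (LieModule.toEnd K L M x) (LieModule.toEnd K L M x') :=
    LinearMap.ext fun m => by simpa [h] using leibniz_lie x x' m
  have key := smul_apply_pow_apply_pow_of_commute (y := y)
    (p := LieModule.toEnd K L M (g i)) (q := LieModule.toEnd K L M (g j))
    (z := LieModule.toEnd K L M ⁅g i, g j⁆)
    (LinearMap.ext fun m => by simp [add_comm])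
    (commute_of_lie_eq_zero hi)
    (commute_of_lie_eq_zero (by rw [← lie_skew (g i), neg_lie, hj, neg_zero])) hy a b
  refine ⟨(a + 1 : K)⁻¹ * (a + 1 - b), ?_⟩
  simp only [lieWord_append, lieWord_replicate (R := K)]
  rw [mul_smul, ← key, inv_smul_smul₀ (Nat.cast_add_one_ne_zero a)]
  rfl

theorem exists_smul_lieWord_replicate_append [DecidableEq ι] (hij : i ≠ j)
    (hi : ⁅⁅g i, g j⁆, g i⁆ = 0) (hj : ⁅⁅g j, g i⁆, g j⁆ = 0) (hy : ⁅g j, y⁆ = 0) {E : List ι}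
    (hE : ∀ l ∈ E, l = i ∨ l = j) :
    ∃ c : K, lieWord g E y =
      c • lieWord g (List.replicate (E.count j) j ++ List.replicate (E.count i) i) y := by
  induction E with
  | nil => exact ⟨1, by simp⟩
  | cons l E ih =>
    obtain ⟨hl, hE⟩ := List.forall_mem_cons.1 hE
    obtain ⟨c, hc⟩ := ih hE
    rw [lieWord_cons, hc, lie_smul]
    obtain rfl | rfl := hl
    · obtain ⟨d, hd⟩ :=
        exists_smul_lie_lieWord_replicate_append K hi hj hy (E.count l) (E.count j)
      rw [hd, smul_smul, List.count_cons_self, List.count_cons_of_ne hij]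
      exact ⟨_, rfl⟩
    · rw [List.count_cons_self, List.count_cons_of_ne hij.symm, List.replicate_succ,
        List.cons_append, lieWord_cons]
      exact ⟨c, rfl⟩

end LieWordCollapse

section InvariantPairing

variable {R L X Y : Type*} [CommRing R] [LieRing L] [AddCommGroup X] [Module R X]
  [LieRingModule L X] [AddCommGroup Y] [Module R Y] [LieRingModule L Y]
  [LieAlgebra R L] [LieModule R L X] [LieModule R L Y]

theorem lie_apply_apply (g : L) (β : X →ₗ[R] Module.Dual R Y) (x : X) (y : Y) :
    ⁅g, β⁆ x y = -β ⁅g, x⁆ y - β x ⁅g, y⁆ := by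
  rw [LieHom.lie_apply, LinearMap.sub_apply, Module.Dual.lie_apply, neg_sub_comm]

theorem flip_lie (g : L) (β : X →ₗ[R] Module.Dual R Y) : LinearMap.flip ⁅g, β⁆ = ⁅g, β.flip⁆ := by
  ext y x
  rw [LinearMap.flip_apply, lie_apply_apply, lie_apply_apply, LinearMap.flip_apply,
    LinearMap.flip_apply, neg_sub_comm]

theorem apply_lieWord_apply_of_lie_eq_zero {ι : Type*} {g : ι → L} {β : X →ₗ[R] Module.Dual R Y}
    (hβ : ∀ i, ⁅g i, β⁆ = 0) (E : List ι) (x : X) (y : Y) :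
    β (lieWord g E x) y = (-1) ^ E.length * β x (lieWord g E.reverse y) := by
  induction E generalizing y with
  | nil => simp
  | cons i E ih =>
    have move (x : X) (y : Y) : β ⁅g i, x⁆ y = -β x ⁅g i, y⁆ := by
      have := lie_apply_apply (g i) β x y
      rw [hβ, LinearMap.zero_apply, LinearMap.zero_apply] at this
      linear_combination this
    rw [lieWord_cons, move, ih, List.reverse_cons, lieWord_append, List.length_cons]
    simp [pow_succ]

end InvariantPairing

section SingularPairing

variable {N : ℕ} {X Y : Type*} [AddCommGroup X] [Module ℂ X] [LieRingModule (SL N) X]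
  [LieModule ℂ (SL N) X] [AddCommGroup Y] [Module ℂ Y] [LieRingModule (SL N) Y]
  [LieModule ℂ (SL N) Y] {x : X} {y : Y} {μ ν : Weight N}

theorem HasWeight.linearMap_apply {f : X →ₗ[ℂ] Y} (hf : HasWeight μ f) (hx : HasWeight ν x) :
    HasWeight (μ + ν) (f x) := by
  intro i
  have := LinearMap.congr_fun (hf i) x
  rw [LieHom.lie_apply, hx i, map_smul, sub_eq_iff_eq_add] at this
  rw [this, LinearMap.smul_apply, ← add_smul, Pi.add_apply, Int.cast_add]

theorem IsHighestWeightVector.flip {β : X →ₗ[ℂ] Module.Dual ℂ Y} (hβ : IsHighestWeightVector μ β) :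
    IsHighestWeightVector μ β.flip := by
  refine ⟨fun h => hβ.1 ?_, fun i => ?_, fun i => ?_⟩
  · rw [← β.flip_flip, h]
    rfl
  · rw [← flip_lie, hβ.2.1]
    rfl
  · rw [← flip_lie, hβ.2.2]
    rfl

variable {Λ₁ Λ₀ : Weight N} {k : Fin N → ℕ} {i j : Fin N} {β : X →ₗ[ℂ] Module.Dual ℂ Y}

theorem IsHighestWeightVector.count_eq_of_apply_lieWord_ne_zero
    (hβ : IsHighestWeightVector (bigLambda Λ₁ Λ₀ k) β) (hx : HasWeight (-Λ₁) x)
    (hy : HasWeight (-Λ₀) y) {E : List (Fin N)} (h : β x (lieWord chevE E y) ≠ 0) (l : Fin N) :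
    E.count l = k l := by
  have weights := (hβ.hasWeight.linearMap_apply hx).add_eq_zero_of_apply_ne_zero
    (hy.lieWord_chevE E) h
  refine sum_map_simpleRoot_eq_iff.1 ?_ l
  rw [bigLambda] at weights
  linear_combination weights

theorem IsHighestWeightVector.apply_lieWord_replicate_ne_zero
    (hβ : IsHighestWeightVector (bigLambda Λ₁ Λ₀ k) β) (hx : HasWeight (-Λ₁) x)
    (hy : HasWeight (-Λ₀) y) (hij : i ≠ j) (hk : ∀ l, l ≠ i → l ≠ j → k l = 0)
    (hj : ⁅(chevE j : SL N), y⁆ = 0) {E E' : List (Fin N)}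
    (h : β (lieWord chevE E x) (lieWord chevE E' y) ≠ 0) :
    β (lieWord chevE (List.replicate (k j) j) x)
      (lieWord chevE (List.replicate (k i) i) y) ≠ 0 := by
  rw [apply_lieWord_apply_of_lie_eq_zero hβ.2.1, ← lieWord_append] at h ⊢
  replace h := right_ne_zero_of_mul h
  have count_eq := hβ.count_eq_of_apply_lieWord_ne_zero hx hy h
  obtain ⟨c, hc⟩ := exists_smul_lieWord_replicate_append ℂ (g := chevE) (y := y)
    (E := E.reverse ++ E') hij (chevE_lie_chevE_lie_chevE i j)
    (chevE_lie_chevE_lie_chevE j i) hj fun l hl => by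
      by_contra! hne
      exact (List.count_pos_iff.2 hl).ne' ((count_eq l).trans (hk l hne.1 hne.2))
  rw [hc, count_eq, count_eq, map_smul] at h
  rw [List.reverse_replicate]
  exact mul_ne_zero (pow_ne_zero _ (neg_ne_zero.2 one_ne_zero)) (right_ne_zero_of_smul h)

end SingularPairing

section TensorPairing

variable {R V M : Type*} [CommRing R] [AddCommGroup V] [Module R V] [AddCommGroup M] [Module R M]

variable (R V M) in
/-- A tensor `w ∈ V ⊗ M` as the pairing `(φ, ψ) ↦ (φ ⊗ ψ) w` of the dual spaces. It turns singular
vectors of a tensor product into singular pairings of the dual modules. -/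
def tensorPairing : V ⊗[R] M →ₗ[R] Module.Dual R V →ₗ[R] Module.Dual R (Module.Dual R M) :=
  TensorProduct.lcurry (.id R) _ _ R ∘ₗ (TensorProduct.dualDistrib R V M).flip

@[simp]
theorem tensorPairing_tmul (x : V) (y : M) (φ : Module.Dual R V) (ψ : Module.Dual R M) :
    tensorPairing R V M (x ⊗ₜ y) φ ψ = φ x * ψ y := rfl

theorem tensorPairing_lie {L : Type*} [LieRing L] [LieAlgebra R L] [LieRingModule L V]
    [LieModule R L V] [LieRingModule L M] [LieModule R L M] (g : L) (w : V ⊗[R] M) :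
    tensorPairing R V M ⁅g, w⁆ = ⁅g, tensorPairing R V M w⁆ := by
  ext φ ψ
  rw [lie_apply_apply]
  induction w using TensorProduct.induction_on with
  | zero => simp
  | add w w' hw hw' =>
    simp only [lie_add, map_add, LinearMap.add_apply, hw, hw']
    ring
  | tmul x y => simp [TensorProduct.LieModule.lie_tmul_right]

end TensorPairing

theorem exists_tensorPairing_apply_ne_zero {ι κ K V M : Type*} [Field K]
    [AddCommGroup V] [Module K V] [AddCommGroup M] [Module K M] {φ : ι → Module.Dual K V}
    {ψ : κ → Module.Dual K M} (hφ : ∀ x, (∀ a, φ a x = 0) → x = 0)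
    (hψ : ∀ y, (∀ b, ψ b y = 0) → y = 0) {w : V ⊗[K] M} (hw : w ≠ 0) :
    ∃ a b, tensorPairing K V M w (φ a) (ψ b) ≠ 0 := by
  let basis := Module.Basis.ofVectorSpace K M
  obtain ⟨x, rfl⟩ := TensorProduct.eq_repr_basis_right basis w
  contrapose! hw
  have combination_eq_zero (a) : ∑ l ∈ x.support, φ a (x l) • basis l = 0 :=
    hψ _ fun b => by simpa [Finsupp.sum] using hw a b
  refine Finset.sum_eq_zero fun l hl => ?_
  have x_l_eq_zero : x l = 0 := hφ _ fun a =>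
    linearIndependent_iff'.1 basis.linearIndependent x.support _ (combination_eq_zero a) l hl
  simp [x_l_eq_zero]

section SingularTensor

variable {N : ℕ} {V M : Type*} [AddCommGroup V] [Module ℂ V] [LieRingModule (SL N) V]
  [LieModule ℂ (SL N) V] [AddCommGroup M] [Module ℂ M] [LieRingModule (SL N) M]
  [LieModule ℂ (SL N) M]

theorem isHighestWeightVector_tensorPairing {μ : Weight N} {w : V ⊗[ℂ] M}
    (hw : IsHighestWeightVector μ w) : IsHighestWeightVector μ (tensorPairing ℂ V M w) := by
  refine hw.map (fun h => ?_) tensorPairing_lie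
  obtain ⟨φ, ψ, hne⟩ := exists_tensorPairing_apply_ne_zero (φ := id) (ψ := id)
    (fun x => (Module.forall_dual_apply_eq_zero_iff ℂ x).1)
    (fun y => (Module.forall_dual_apply_eq_zero_iff ℂ y).1) hw.1
  exact hne (by rw [h]; rfl)

end SingularTensor

section Symmetrization

theorem sum_one_div_sub_mul_prod_erase {ι K : Type*} [DecidableEq ι] [Field K] {s : Finset ι}
    (hs : s.Nonempty) {z : K} {t : ι → K} (ht : Set.InjOn t s) (hz : ∀ i ∈ s, t i ≠ z) :
    ∑ p ∈ s, 1 / (t p - z) * ∏ j ∈ s.erase p, 1 / (t j - t p) = ∏ i ∈ s, 1 / (t i - z) := by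
  have eval_interpolate_one := Lagrange.eval_interpolate_not_at_node (s := s) (v := fun i => -t i)
    (x := -z) 1 fun i hi h => hz i hi (neg_injective h).symm
  rw [Lagrange.interpolate_one (fun a ha b hb h => ht ha hb (neg_injective h)) hs,
    Polynomial.eval_one, Lagrange.eval_nodal] at eval_interpolate_one
  have prod_ne_zero : ∏ i ∈ s, (t i - z) ≠ 0 :=
    Finset.prod_ne_zero_iff.2 fun i hi => sub_ne_zero.2 (hz i hi)
  rw [Finset.prod_div_distrib, Finset.prod_const_one, eq_div_iff prod_ne_zero, mul_comm]
  simpa only [Lagrange.nodalWeight, Pi.one_apply, mul_one, neg_sub_neg, ← one_div,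
    mul_comm (1 / (_ - z))] using eval_interpolate_one.symm

theorem swap_zero_succ_ne {n : ℕ} (p : Fin (n + 1)) (i : Fin n) : Equiv.swap 0 p i.succ ≠ p := by
  rw [Ne, Equiv.swap_apply_eq_iff, Equiv.swap_apply_right]
  exact Fin.succ_ne_zero i

theorem prod_erase_eq_prod_swap_zero_succ {M : Type*} [CommMonoid M] {n : ℕ} (p : Fin (n + 1))
    (f : Fin (n + 1) → M) :
    ∏ j ∈ Finset.univ.erase p, f j = ∏ i : Fin n, f (Equiv.swap 0 p i.succ) := by
  refine (Finset.prod_nbij (fun i : Fin n => Equiv.swap 0 p i.succ) (fun i _ => ?_)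
    ((Equiv.injective _).comp (Fin.succ_injective n)).injOn (fun j hj => ?_) fun _ _ => rfl).symm
  · simpa using swap_zero_succ_ne p i
  · obtain ⟨i, hi⟩ := Fin.exists_succ_eq_of_ne_zero (x := Equiv.swap 0 p j) fun h => by
      simp_all [Equiv.swap_apply_eq_iff]
    exact ⟨i, Finset.mem_coe.2 (Finset.mem_univ i), by simp [hi]⟩

theorem rowFraction_append_singleton (z a : ℂ) (l : List ℂ) :
    rowFraction z (l ++ [a]) = rowFraction a l * (1 / (a - z)) := by
  induction l with
  | nil => simp [rowFraction]
  | cons b l ih =>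
    cases l with
    | nil => simp [rowFraction]
    | cons c l =>
      simp only [List.cons_append, rowFraction] at ih ⊢
      rw [ih, mul_assoc]

theorem sum_perm_rowFraction_reverse {n : ℕ} {z : ℂ} {t : Fin n → ℂ} (ht : Function.Injective t)
    (hz : ∀ i, t i ≠ z) :
    ∑ π : Equiv.Perm (Fin n), rowFraction z (List.ofFn fun i => t (π i)).reverse =
      ∏ i, 1 / (t i - z) := by
  induction n generalizing z with
  | zero => simp [rowFraction]
  | succ n ih =>
    rw [← sum_one_div_sub_mul_prod_erase Finset.univ_nonempty ht.injOn fun i _ => hz i,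
      ← Equiv.sum_comp Equiv.Perm.decomposeFin.symm, Fintype.sum_prod_type]
    refine Finset.sum_congr rfl fun p _ => ?_
    rw [prod_erase_eq_prod_swap_zero_succ,
      ← ih (t := fun i => t (Equiv.swap 0 p i.succ))
        (fun a b h => Fin.succ_injective _ ((Equiv.swap 0 p).injective (ht h)))
        (fun i h => swap_zero_succ_ne p i (ht h)),
      Finset.mul_sum]
    refine Finset.sum_congr rfl fun e _ => ?_
    rw [List.ofFn_succ, List.reverse_cons, rowFraction_append_singleton, mul_comm]
    simp

theorem sum_perm_rowFraction {n : ℕ} {z : ℂ} {t : Fin n → ℂ} (ht : Function.Injective t)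
    (hz : ∀ i, t i ≠ z) :
    ∑ π : Equiv.Perm (Fin n), rowFraction z (List.ofFn fun i => t (π i)) =
      ∏ i, 1 / (t i - z) := by
  rw [← sum_perm_rowFraction_reverse ht hz, ← Equiv.sum_comp (Equiv.mulRight Fin.revPerm)]
  refine Finset.sum_congr rfl fun π _ => ?_
  refine congrArg _ (List.ext_getElem (by simp) fun m _ _ => ?_)
  simp [List.getElem_reverse, Fin.rev, Nat.sub_add_eq, Nat.sub_right_comm]

end Symmetrization

section WeightFunction

variable {N : ℕ} {k : Fin N → ℕ} {i j : Fin N}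

theorem replicate_mem_wordPairs (hij : i ≠ j) (hk : ∀ l, l ≠ i → l ≠ j → k l = 0) :
    (List.replicate (k i) i, List.replicate (k j) j) ∈ wordPairs k := by
  simp only [wordPairs, Set.Finite.mem_toFinset, Set.mem_ofPred_eq, List.count_append,
    List.count_replicate, beq_iff_eq]
  grind

theorem length_substVars (t : Vars k) (w : List (Fin N)) : (substVars t w).length = w.length :=
  List.length_mapIdx

theorem getElem_substVars (t : Vars k) (w : List (Fin N)) {m : ℕ} (hm : m < w.length) :
    (substVars t w)[m]'(by rwa [length_substVars]) =
      if h : (w.take m).count w[m] < k w[m] then t w[m] ⟨_, h⟩ else 0 :=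
  List.getElem_mapIdx

theorem substVars_append_replicate (t : Vars k) {w : List (Fin N)} (hw : i ∉ w) :
    substVars t (w ++ List.replicate (k i) i) = substVars t w ++ List.ofFn (t i) := by
  refine List.ext_getElem (by simp [length_substVars]) fun m hm _ => ?_
  rw [length_substVars] at hm
  rw [getElem_substVars t _ hm]
  rw [List.length_append, List.length_replicate] at hm
  by_cases h : m < w.length
  · rw [List.getElem_append_left h, List.take_append_of_le_length h.le,
      List.getElem_append_left (by rwa [length_substVars]), getElem_substVars t w h]
  · have count_eq : ((w ++ List.replicate (k i) i).take m).count i = m - w.length := by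
      rw [List.take_append, List.take_of_length_le (not_lt.1 h), List.count_append,
        List.count_eq_zero_of_not_mem hw, List.take_replicate, List.count_replicate_self]
      omega
    rw [List.getElem_append_right (not_lt.1 h), List.getElem_replicate, dif_pos (by omega),
      List.getElem_append_right (by rwa [length_substVars, ← not_lt]), List.getElem_ofFn]
    simp only [count_eq, length_substVars]

theorem substVars_replicate_append (hij : i ≠ j) (t : Vars k) :
    substVars t (List.replicate (k i) i ++ List.replicate (k j) j) =
      List.ofFn (t i) ++ List.ofFn (t j) := by
  rw [substVars_append_replicate t (by simp [hij.symm])]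
  congr 1
  exact substVars_append_replicate t (w := []) (by simp)

theorem gFun_replicate (hij : i ≠ j) (hk : ∀ l, l ≠ i → l ≠ j → k l = 0) (t : Vars k) :
    gFun (List.replicate (k i) i, List.replicate (k j) j) t =
      ∏ l, rowFraction (if l = i then 1 else 0) (List.ofFn (t l)) := by
  rw [gFun]
  simp only [substVars_replicate_append hij, List.length_replicate]
  rw [List.take_left' (by simp), List.drop_left' (by simp),
    Finset.prod_eq_mul i j hij _ (by simp) (by simp), if_pos rfl, if_neg hij.symm]
  rintro l - ⟨hli, hlj⟩
  rw [List.ofFn_eq_nil_iff.2 (hk l hli hlj), rowFraction]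

theorem InDomain.injective {t : Vars k} (ht : InDomain t) (l : Fin N) : Function.Injective (t l) :=
  ht.1.comp sigma_mk_injective

theorem InDomain.apply_ne {t : Vars k} (ht : InDomain t) (i l : Fin N) (s : Fin (k l)) :
    t l s ≠ if l = i then 1 else 0 := by
  split_ifs
  exacts [(ht.2 l s).2, (ht.2 l s).1]

theorem omegaFun_replicate (hij : i ≠ j) (hk : ∀ l, l ≠ i → l ≠ j → k l = 0) {t : Vars k}
    (ht : InDomain t) : omegaFun (List.replicate (k i) i, List.replicate (k j) j) t =
      ∏ l, ∏ s, 1 / (t l s - if l = i then 1 else 0) := by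
  simp only [omegaFun, gFun_replicate hij hk,
    ← sum_perm_rowFraction (ht.injective _) (ht.apply_ne i _)]
  rw [Finset.prod_univ_sum, Fintype.piFinset_univ]

theorem omegaFun_replicate_ne_zero (hij : i ≠ j) (hk : ∀ l, l ≠ i → l ≠ j → k l = 0) {t : Vars k}
    (ht : InDomain t) : omegaFun (List.replicate (k i) i, List.replicate (k j) j) t ≠ 0 := by
  rw [omegaFun_replicate hij hk ht]
  exact Finset.prod_ne_zero_iff.2 fun l _ => Finset.prod_ne_zero_iff.2 fun s _ =>
    one_div_ne_zero (sub_ne_zero.2 (ht.apply_ne i l s))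

end WeightFunction

section Nonvanishing

variable {N : ℕ} {V₁ V₀ : Type*} [AddCommGroup V₁] [Module ℂ V₁] [LieRingModule (SL N) V₁]
  [AddCommGroup V₀] [Module ℂ V₀] [LieRingModule (SL N) V₀] {Λ₁ Λ₀ : Weight N} {k : Fin N → ℕ}

theorem tensorPairing_universalWeight (v₁ : V₁) (v₀ : V₀) (t : Vars k) (φ₁ : Module.Dual ℂ V₁)
    (φ₀ : Module.Dual ℂ V₀) :
    tensorPairing ℂ V₁ V₀ (universalWeight v₁ v₀ t) φ₁ φ₀ =
      ∑ p ∈ wordPairs k, omegaFun p t * (φ₁ (wordAct p.1 v₁) * φ₀ (wordAct p.2 v₀)) := by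
  simp only [universalWeight, map_sum, map_smul, LinearMap.sum_apply, LinearMap.smul_apply,
    tensorPairing_tmul, smul_eq_mul]

variable [LieModule ℂ (SL N) V₁] [LieModule ℂ (SL N) V₀]

theorem IsComponentHighestWeight.exists_isHighestWeightVector {Λ : Weight N}
    (h : IsComponentHighestWeight V₁ Λ) : ∃ w : V₁, IsHighestWeightVector Λ w := by
  obtain ⟨W, -, w, hw⟩ := h
  exact ⟨w, hw.map (f := (W.incl : W →ₗ[ℂ] V₁)) (fun h => hw.1 (Subtype.ext h))
    fun _ _ => rfl⟩

variable [LieModule.IsIrreducible ℂ (SL N) V₁] [LieModule.IsIrreducible ℂ (SL N) V₀]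
  {v₁ : V₁} {v₀ : V₀} {φ₁ : Module.Dual ℂ V₁} {φ₀ : Module.Dual ℂ V₀} {i j : Fin N}

theorem universalWeight_ne_zero_of_lieWord_replicate_ne_zero (hv₁ : IsHighestWeightVector Λ₁ v₁)
    (hv₀ : IsHighestWeightVector Λ₀ v₀) (hφ₁ : HasWeight (-Λ₁) φ₁) (hφ₀ : HasWeight (-Λ₀) φ₀)
    (hij : i ≠ j) (hk : ∀ l, l ≠ i → l ≠ j → k l = 0)
    (h₁ : lieWord chevE (List.replicate (k i) i) φ₁ ≠ 0)
    (h₀ : lieWord chevE (List.replicate (k j) j) φ₀ ≠ 0) {t : Vars k} (ht : InDomain t) :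
    universalWeight v₁ v₀ t ≠ 0 := by
  suffices tensorPairing ℂ V₁ V₀ (universalWeight v₁ v₀ t)
      (lieWord chevE (List.replicate (k i) i) φ₁) (lieWord chevE (List.replicate (k j) j) φ₀) ≠ 0 by
    contrapose! this
    simp [this]
  rw [tensorPairing_universalWeight, Finset.sum_eq_single_of_mem _ (replicate_mem_wordPairs hij hk)]
  · exact mul_ne_zero (omegaFun_replicate_ne_zero hij hk ht)
      (mul_ne_zero (hv₁.lieWord_chevE_replicate_apply_ne_zero hφ₁ h₁)
        (hv₀.lieWord_chevE_replicate_apply_ne_zero hφ₀ h₀))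
  · rintro ⟨F₁, F₀⟩ - hF
    contrapose! hF
    obtain ⟨-, hF₁, hF₀⟩ := mul_ne_zero_iff.1 hF |>.imp_right mul_ne_zero_iff.1
    exact Prod.ext
      (List.perm_replicate.1
        (hφ₁.perm_of_lieWord_chevE_apply_wordAct_ne_zero hv₁.hasWeight hF₁))
      (List.perm_replicate.1
        (hφ₀.perm_of_lieWord_chevE_apply_wordAct_ne_zero hv₀.hasWeight hF₀))

theorem exists_tensorPairing_lieWord_chevE_ne_zero {μ₁ μ₀ : Weight N}
    (hφ₁ : IsLowestWeightVector μ₁ φ₁) (hφ₀ : IsLowestWeightVector μ₀ φ₀) {w : V₁ ⊗[ℂ] V₀}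
    (hw : w ≠ 0) : ∃ E E' : List (Fin N),
      tensorPairing ℂ V₁ V₀ w (lieWord chevE E φ₁) (lieWord chevE E' φ₀) ≠ 0 :=
  exists_tensorPairing_apply_ne_zero
    (fun _ => hφ₁.eq_zero_of_forall_lieWord_apply_eq_zero)
    (fun _ => hφ₀.eq_zero_of_forall_lieWord_apply_eq_zero) hw

end Nonvanishing

end Gaudin

end

theorem mainTheorem5_general {N : ℕ} {V₁ V₀ : Type*}
    [AddCommGroup V₁] [Module ℂ V₁] [LieRingModule (Gaudin.SL N) V₁]
    [LieModule ℂ (Gaudin.SL N) V₁] [LieModule.IsIrreducible ℂ (Gaudin.SL N) V₁]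
    [AddCommGroup V₀] [Module ℂ V₀] [LieRingModule (Gaudin.SL N) V₀]
    [LieModule ℂ (Gaudin.SL N) V₀] [LieModule.IsIrreducible ℂ (Gaudin.SL N) V₀]
    {Λ₁ Λ₀ : Gaudin.Weight N} {v₁ : V₁} {v₀ : V₀}
    (hv₁ : Gaudin.IsHighestWeightVector Λ₁ v₁) (hv₀ : Gaudin.IsHighestWeightVector Λ₀ v₀)
    {i j : Fin N} (hij : i ≠ j) (hj : Λ₀ j = 0 ∨ Λ₁ j = 0)
    {k : Fin N → ℕ} (hk : ∀ l, l ≠ i → l ≠ j → k l = 0)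
    {w : V₁ ⊗[ℂ] V₀} (hw : Gaudin.IsHighestWeightVector (Gaudin.bigLambda Λ₁ Λ₀ k) w)
    {t : Gaudin.Vars k} (ht : Gaudin.InDomain t) : Gaudin.universalWeight v₁ v₀ t ≠ 0 := by
  obtain ⟨φ₁, hφ₁⟩ := hv₁.exists_isLowestWeightVector_dual
  obtain ⟨φ₀, hφ₀⟩ := hv₀.exists_isLowestWeightVector_dual
  have singular := Gaudin.isHighestWeightVector_tensorPairing hw
  obtain ⟨E, E', hE⟩ := Gaudin.exists_tensorPairing_lieWord_chevE_ne_zero hφ₁ hφ₀ hw.1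
  obtain hj | hj := hj
  · have h := singular.apply_lieWord_replicate_ne_zero hφ₁.2.2 hφ₀.2.2 hij hk
      (hv₀.lie_chevE_dual_eq_zero hφ₀.2.2 hj) hE
    exact Gaudin.universalWeight_ne_zero_of_lieWord_replicate_ne_zero hv₁ hv₀ hφ₁.2.2 hφ₀.2.2
      hij.symm (fun l hlj hli => hk l hli hlj) (fun h₁ => h (by rw [h₁, map_zero]; rfl))
      (ne_zero_of_map h) ht
  · rw [Gaudin.bigLambda, add_comm Λ₁] at singular
    have h := singular.flip.apply_lieWord_replicate_ne_zero hφ₀.2.2 hφ₁.2.2 hij hk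
      (hv₁.lie_chevE_dual_eq_zero hφ₁.2.2 hj) hE
    exact Gaudin.universalWeight_ne_zero_of_lieWord_replicate_ne_zero hv₁ hv₀ hφ₁.2.2 hφ₀.2.2
      hij hk (ne_zero_of_map h) (fun h₀ => h (by rw [h₀, map_zero]; rfl)) ht

theorem mainTheorem5 :
    (∀ (N : ℕ) (_ : 2 ≤ N) (V₁ : Type u) (V₀ : Type v)
      [AddCommGroup V₁] [Module ℂ V₁] [LieRingModule (Gaudin.SL N) V₁]
      [LieModule ℂ (Gaudin.SL N) V₁] [FiniteDimensional ℂ V₁]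
      [LieModule.IsIrreducible ℂ (Gaudin.SL N) V₁]
      [AddCommGroup V₀] [Module ℂ V₀] [LieRingModule (Gaudin.SL N) V₀]
      [LieModule ℂ (Gaudin.SL N) V₀] [FiniteDimensional ℂ V₀]
      [LieModule.IsIrreducible ℂ (Gaudin.SL N) V₀]
      (Λ₁ Λ₀ : Gaudin.Weight N) (v₁ : V₁) (v₀ : V₀)
      (_ : Gaudin.IsHighestWeightVector Λ₁ v₁) (_ : Gaudin.IsHighestWeightVector Λ₀ v₀)
      (m : ℕ) (_ : Λ₀ = m • Gaudin.lam 0)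
      (k : Fin N → ℕ) (_ : ∀ i : Fin N, 2 ≤ (i : ℕ) → k i = 0)
      (_ : Gaudin.IsComponentHighestWeight (V₁ ⊗[ℂ] V₀) (Gaudin.bigLambda Λ₁ Λ₀ k))
      (t : Gaudin.Vars k) (_ : Gaudin.InDomain t),
      Gaudin.universalWeight v₁ v₀ t ≠ 0) ∧
    (∀ (V₁ : Type u) (V₀ : Type v)
      [AddCommGroup V₁] [Module ℂ V₁] [LieRingModule (Gaudin.SL 2) V₁]
      [LieModule ℂ (Gaudin.SL 2) V₁] [FiniteDimensional ℂ V₁]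
      [LieModule.IsIrreducible ℂ (Gaudin.SL 2) V₁]
      [AddCommGroup V₀] [Module ℂ V₀] [LieRingModule (Gaudin.SL 2) V₀]
      [LieModule ℂ (Gaudin.SL 2) V₀] [FiniteDimensional ℂ V₀]
      [LieModule.IsIrreducible ℂ (Gaudin.SL 2) V₀]
      (Λ₁ Λ₀ : Gaudin.Weight 2) (v₁ : V₁) (v₀ : V₀)
      (_ : Gaudin.IsHighestWeightVector Λ₁ v₁) (_ : Gaudin.IsHighestWeightVector Λ₀ v₀)
      (_ : ∃ m : ℕ, Λ₀ = m • Gaudin.lam 0 ∨ Λ₁ = m • Gaudin.lam 0)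
      (x : V₁ ⊗[ℂ] V₀) (_ : Gaudin.IsBetheVector Λ₁ Λ₀ v₁ v₀ x),
      x ≠ 0) := by
  refine ⟨?_, ?_⟩
  · intro N hN V₁ V₀ _ _ _ _ _ _ _ _ _ _ _ _ Λ₁ Λ₀ v₁ v₀ hv₁ hv₀ m hΛ k hk component t ht
    obtain ⟨w, hw⟩ := component.exists_isHighestWeightVector
    refine mainTheorem5_general hv₁ hv₀ (i := ⟨0, by omega⟩) (j := ⟨1, by omega⟩) (by simp)
      (.inl (hΛ ▸ Gaudin.smul_lam_zero_apply m one_ne_zero)) (fun l hl₀ hl₁ => hk l ?_) hw ht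
    simp only [ne_eq, Fin.ext_iff] at hl₀ hl₁
    omega
  · rintro V₁ V₀ _ _ _ _ _ _ _ _ _ _ _ _ Λ₁ Λ₀ v₁ v₀ hv₁ hv₀ ⟨m, hΛ⟩ _
      ⟨k, t, component, ht, -, rfl⟩
    obtain ⟨w, hw⟩ := component.exists_isHighestWeightVector
    have vanishes : Λ₀ 1 = 0 ∨ Λ₁ 1 = 0 :=
      hΛ.imp (fun h => by rw [h, Gaudin.smul_lam_zero_apply m one_ne_zero])
        (fun h => by rw [h, Gaudin.smul_lam_zero_apply m one_ne_zero])
    exact mainTheorem5_general hv₁ hv₀ (i := 0) (j := 1) zero_ne_one vanishes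
      (fun l hl₀ hl₁ => by omega) hw ht
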